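/- Let $R$ be a discrete valuation ring with maximal ideal $m_R$ and residue field $k_R$, and let $A$ be a finite and flat commutative $R$-algebra, so that $A$ is free of finite rank $\operatorname{rk}A$ as an $R$-module. Let $\mathrm{tr}_{A/R}\colon A\to R$ be the trace map, and put $$\mathcal Q_{A/R}=\operatorname{Coker}\bigl(A\to \operatorname{Hom}_R(A,R),\ a\mapsto \mathrm{tr}_{A/R}(a\cdot -)\bigr),\qquad f^{A/R}=\operatorname{length}_R(\mathcal Q_{A/R})\in\mathbb N\cup\{\infty\}.$$ For a maximal ideal $p$ of $A$ (which necessarily lies over $m_R$) let $$e(p,A/R)=\frac{\dim_{k_R}(A_p\otimes_R k_R)}{[A/p:k_R]},$$ which is a natural number. Say that $A/R$ is tame if, for every maximal ideal $p$ of $A$, $e(p,A/R)$ is coprime with $\operatorname{char}k_R$ (no condition if $\operatorname{char}k_R=0$), and that $A/R$ has separable residue fields if, for every maximal ideal $p$ of $A$, the finite extension $(A/p)/k_R$ is separable. Let $\overline{k_R}$ be an algebraic closure of $k_R$ and let $|\operatorname{Spec}(A\otimes_R\overline{k_R})|$ be the number of prime ideals of $A\otimes_R\overline{k_R}$. Then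 $$f^{A/R}\ \geq\ \operatorname{rk}A-|\operatorname{Spec}(A\otimes_R\overline{k_R})|,$$ and the following conditions are equivalent: (1) equality holds in the inequality above; (2) $A$ is regular (that is, all its localizations at prime ideals are regular local rings), and $A/R$ is tame with separable residue fields; (3) $A/R$ is tame with separable residue fields and $m_R\,\mathcal Q_{A/R}=0$. -/

import Mathlib

open scoped TensorProduct

noncomputable section

namespace FiniteFlatExtension

open IsLocalRing

variable (R : Type*) [CommRing R] (A : Type*) [CommRing A] [Algebra R A]

/-- The cokernel `Q_{A/R}` of the map `A → Hom_R(A, R)`, `a ↦ tr_{A/R}(a * -)`. -/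
abbrev TraceCokernel : Type _ :=
  Module.Dual R A ⧸ LinearMap.range (Algebra.traceForm R A)

/-- `f^{A/R}`: the length (in `ℕ∞`) of the `R`-module `Q_{A/R}`. -/
def traceLength : ℕ∞ := Module.length R (TraceCokernel R A)

variable [IsLocalRing R]

/-- The number of primes of `A ⊗_R k̄`, where `k̄` is an algebraic closure of the residue field
of `R`. -/
def geometricPoints : ℕ∞ :=
  ENat.card (PrimeSpectrum (A ⊗[R] AlgebraicClosure (ResidueField R)))

variable {A} in
/-- The ramification index
`e(p, A/R) = dim_k (A_p ⊗_R k) / [A/p : k]`, `k = R/m_R`,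
of a maximal ideal `p` of `A` lying over the maximal ideal `m_R` of the local ring `R`.
For finite `A` this quotient of natural numbers is exact. -/
def ramificationIndex (p : Ideal A) [p.IsMaximal] [p.LiesOver (maximalIdeal R)] : ℕ :=
  Module.finrank (R ⧸ maximalIdeal R)
      ((R ⧸ maximalIdeal R) ⊗[R] Localization.AtPrime p) /
    Module.finrank (R ⧸ maximalIdeal R) (A ⧸ p)

/-- `A/R` is tame (over the maximal ideal of `R`): all ramification indices are prime to the
characteristic of the residue field, which is no condition in residue characteristic zero.
If `A` is finite over `R`, every maximal ideal of `A` lies over the maximal ideal of `R`. -/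
def IsTame : Prop :=
  ∀ (p : Ideal A) [p.IsMaximal] [p.LiesOver (maximalIdeal R)],
    ringChar (ResidueField R) = 0 ∨
      (ramificationIndex R p).Coprime (ringChar (ResidueField R))

/-- `A/R` has separable residue fields (over the maximal ideal of `R`): for every maximal ideal
`p` of `A` the extension `A/p` of `R/m_R` is separable. -/
def HasSeparableResidueFields : Prop :=
  ∀ (p : Ideal A) [p.IsMaximal] [p.LiesOver (maximalIdeal R)],
    Algebra.IsSeparable (R ⧸ maximalIdeal R) (A ⧸ p)

end FiniteFlatExtension

end

/-! Let `k` be the residue field, `B = k ⊗ A`, `n = rk A`, `Q` the trace cokernel, `r` the rank of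
the trace form of `B`, and `g` the number of geometric points. Reducing linear forms modulo `m_R`
identifies `Q / m_R Q` with the trace cokernel of `B`, of dimension `n - r`. Hence `length Q + r = n
+ length (m_R Q)` (`traceLength_add_finrank_range`).

By dévissage, the trace of `B` is `∑ c_q tr_{(B/q)/k}`, where `c_q` is the ramification index of the
corresponding maximal ideal of `A`. A summand vanishes when `c_q = 0` in `k` or `B/q` is
inseparable. The others contribute `[B/q : k]`, the number of embeddings of `B/q` into an algebraic
closure, to `r`. As `g` counts these embeddings over all `q`, `r ≤ g`, with equality exactly in the
tame case with separable residue fields. This gives the inequality and (1) ⇔ (3).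

In that case `tr(aA) ⊆ m_R` iff `a` lies in the Jacobson radical `J` of `A`; let `π` be a
uniformizer. If `m_R Q = 0`, every `πφ` is a form `tr(x·)` with `x ∈ J`. Testing these forms on some
`b ∉ πA` with `pb ⊆ πA` yields a generator of `pA_p`, so `A` is regular. Conversely, regularity
gives enough forms `ψ` with `πψ = tr(x·)` to separate the points of `B`; duality and Nakayama then
give all forms. -/

namespace FiniteFlatExtension

/-! ### Trace of a finite algebra over a field as a weighted sum of residue field traces -/

section TraceFormula

variable {k : Type*} [Field k]

/-- Splittings decompose the identity of `V₂` as `i r' + s g`; cyclicity of the trace moves the two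
summands to `V₁` and `V₃`. Correcting `r` to `r' = r - r s g` makes it vanish on the image of `s`.
-/
lemma trace_eq_add_of_exact {V₁ V₂ V₃ : Type*} [AddCommGroup V₁] [AddCommGroup V₂]
    [AddCommGroup V₃] [Module k V₁] [Module k V₂] [Module k V₃] [Module.Finite k V₁]
    [Module.Finite k V₂] [Module.Finite k V₃] (i : V₁ →ₗ[k] V₂) (g : V₂ →ₗ[k] V₃)
    (hi : Function.Injective i) (hg : Function.Surjective g) (hig : Function.Exact i g)
    (f₁ : V₁ →ₗ[k] V₁) (f₂ : V₂ →ₗ[k] V₂) (f₃ : V₃ →ₗ[k] V₃)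
    (h₁ : f₂ ∘ₗ i = i ∘ₗ f₁) (h₃ : g ∘ₗ f₂ = f₃ ∘ₗ g) :
    LinearMap.trace k V₂ f₂ = LinearMap.trace k V₁ f₁ + LinearMap.trace k V₃ f₃ := by
  obtain ⟨s, hs⟩ := g.exists_rightInverse_of_surjective (LinearMap.range_eq_top.2 hg)
  obtain ⟨r, hr⟩ := i.exists_leftInverse_of_injective (LinearMap.ker_eq_bot.2 hi)
  have hs' (x) : g (s x) = x := LinearMap.congr_fun hs x
  have hr' (x) : r (i x) = x := LinearMap.congr_fun hr x
  have hgi (x) : g (i x) = 0 := hig.apply_apply_eq_zero x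
  have hid : i ∘ₗ (r - r ∘ₗ s ∘ₗ g) + s ∘ₗ g = LinearMap.id := by
    ext y
    obtain ⟨z, hz⟩ := (hig (y - s (g y))).1 (by simp [hs'])
    have : r y - r (s (g y)) = z := by rw [← map_sub, ← hz, hr']
    simp [this, hz]
  have hr2 : (r - r ∘ₗ s ∘ₗ g) ∘ₗ i = LinearMap.id := by
    ext x; simp [hr', hgi]
  calc LinearMap.trace k V₂ f₂
      = LinearMap.trace k V₂ ((f₂ ∘ₗ i) ∘ₗ (r - r ∘ₗ s ∘ₗ g) + (f₂ ∘ₗ s) ∘ₗ g) := by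
        rw [LinearMap.comp_assoc, LinearMap.comp_assoc, ← LinearMap.comp_add, hid,
          LinearMap.comp_id]
    _ = _ := by
        rw [map_add, LinearMap.trace_comp_comm' g (f₂ ∘ₗ s), h₁,
          LinearMap.trace_comp_comm' (r - r ∘ₗ s ∘ₗ g) (i ∘ₗ f₁),
          ← LinearMap.comp_assoc, hr2, LinearMap.id_comp, ← LinearMap.comp_assoc, h₃,
          LinearMap.comp_assoc, hs, LinearMap.comp_id]

variable {B : Type*} [CommRing B] [Algebra k B]

/-- The complement of `q` already acts bijectively on `B ⧸ q`, so localizing at `q` changes nothing.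
-/
lemma length_localization_tensor_of_equiv_quotient_self (q : Ideal B) [q.IsMaximal]
    {M : Type*} [AddCommGroup M] [Module B M] [Module k M] [IsScalarTower k B M]
    (e : M ≃ₗ[B] B ⧸ q) :
    Module.length k (Localization.AtPrime q ⊗[B] M) = Module.length k (B ⧸ q) := by
  have hunit (s : q.primeCompl) : Function.Bijective (fun m : M ↦ (s : B) • m) := by
    have hs : IsUnit (Ideal.Quotient.mk q (s : B)) := by
      let _ := Ideal.Quotient.field q
      exact isUnit_iff_ne_zero.2 fun h ↦ s.2 (Ideal.Quotient.eq_zero_iff_mem.1 h)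
    obtain ⟨v, hv⟩ := hs.exists_right_inv
    obtain ⟨t, rfl⟩ := Ideal.Quotient.mk_surjective v
    have ht (m : M) : (t * s : B) • m = m := by
      apply e.injective
      rw [map_smul, Algebra.smul_def, Ideal.Quotient.algebraMap_eq, map_mul,
        mul_comm (Ideal.Quotient.mk q t), hv, one_mul]
    refine ⟨fun m m' h ↦ ?_, fun m ↦ ⟨t • m, ?_⟩⟩
    · rw [← ht m, ← ht m', mul_smul, mul_smul]; exact congrArg (t • ·) h
    · simp only; rw [smul_smul, mul_comm, ht]
  let f : M →ₗ[k] Localization.AtPrime q ⊗[B] M :=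
    (TensorProduct.mk B (Localization.AtPrime q) M 1).restrictScalars k
  have hf : IsLocalizedModule q.primeCompl (TensorProduct.mk B (Localization.AtPrime q) M 1) :=
    inferInstance
  have : Function.Bijective f := by
    refine ⟨(injective_iff_map_eq_zero f).2 fun m hm ↦ ?_, fun y ↦ ?_⟩
    · obtain ⟨s, hs⟩ := (IsLocalizedModule.eq_zero_iff q.primeCompl
        (TensorProduct.mk B (Localization.AtPrime q) M 1)).1 hm
      exact (hunit s).1 (hs.trans (smul_zero _).symm)
    · obtain ⟨⟨m, s⟩, hs⟩ := IsLocalizedModule.surj q.primeCompl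
        (TensorProduct.mk B (Localization.AtPrime q) M 1) y
      obtain ⟨m', rfl⟩ := (hunit s).2 m
      refine ⟨m', IsLocalizedModule.smul_injective
        (TensorProduct.mk B (Localization.AtPrime q) M 1) s ?_⟩
      simp only
      rw [hs]
      simp only [map_smul]
      rfl
  rw [← (LinearEquiv.ofBijective f this).length_eq, (e.restrictScalars k).length_eq]

lemma subsingleton_localization_tensor_of_equiv_quotient {q q' : Ideal B} [q.IsMaximal]
    [q'.IsMaximal] (h : q' ≠ q)
    {M : Type*} [AddCommGroup M] [Module B M] (e : M ≃ₗ[B] B ⧸ q') :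
    Subsingleton (Localization.AtPrime q ⊗[B] M) := by
  obtain ⟨s, hs', hs⟩ := SetLike.not_le_iff_exists.1
    fun hle ↦ h (Ideal.IsMaximal.eq_of_le ‹_› (Ideal.IsMaximal.ne_top ‹_›) hle)
  have hsM (m : M) : s • m = 0 := by
    apply e.injective
    rw [map_smul, map_zero, Algebra.smul_def, Ideal.Quotient.algebraMap_eq,
      Ideal.Quotient.eq_zero_iff_mem.2 hs', zero_mul]
  refine subsingleton_of_forall_eq 0 fun y ↦ ?_
  have hinj := IsLocalizedModule.smul_injective
        (TensorProduct.mk B (Localization.AtPrime q) M 1) (⟨s, hs⟩ : q.primeCompl)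
  apply hinj
  simp only [smul_zero]
  induction y with
  | zero => simp
  | tmul x m => 
    change s • (x ⊗ₜ[B] m) = 0
    rw [← TensorProduct.tmul_smul, hsM, TensorProduct.tmul_zero]
  | add x y hx hy => rw [smul_add, hx, hy, add_zero]

lemma trace_lsmul_of_equiv_quotient {I : Ideal B} {M : Type*} [AddCommGroup M] [Module B M]
    [Module k M] [IsScalarTower k B M] (e : M ≃ₗ[B] B ⧸ I) (b : B) :
    LinearMap.trace k M (Algebra.lsmul k k M b) =
      Algebra.trace k (B ⧸ I) (Ideal.Quotient.mk I b) := by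
  have h : (e.restrictScalars k).conj (Algebra.lsmul k k M b) =
      Algebra.lmul k (B ⧸ I) (Ideal.Quotient.mk I b) := by
    refine LinearMap.ext fun x ↦ ?_
    change e (b • e.symm x) = Ideal.Quotient.mk I b * x
    rw [map_smul, e.apply_symm_apply, Algebra.smul_def, Ideal.Quotient.algebraMap_eq]
  rw [Algebra.trace_apply, ← h, LinearMap.trace_conj']

variable [Module.Finite k B] [Fintype (MaximalSpectrum B)]

variable (k) in
-- Dévissage: lengths of localizations and traces are additive in exact sequences, which reduces to
-- `B ⧸ p`. The `k`-structure is quantified inside the statement because the induction runs over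
-- bare `B`-modules.
lemma exists_multiplicity_trace_lsmul_eq_sum (M : Type*) [AddCommGroup M] [Module B M]
    (hM : Module.Finite B M) : ∀ [Module k M] [IsScalarTower k B M],
    ∃ c : MaximalSpectrum B → ℕ,
      (∀ q, Module.length k (Localization.AtPrime q.asIdeal ⊗[B] M) =
        c q * Module.finrank k (B ⧸ q.asIdeal)) ∧
      ∀ b : B, LinearMap.trace k M (Algebra.lsmul k k M b) =
        ∑ q, (c q : k) * Algebra.trace k (B ⧸ q.asIdeal) (Ideal.Quotient.mk _ b) := by
  classical
  have hart : IsArtinianRing B := isArtinian_of_tower k inferInstance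
  induction hM using IsNoetherianRing.induction_on_isQuotientEquivQuotientPrime B with
  | subsingleton N =>
    intro _ _
    refine ⟨0, fun q ↦ ?_, fun b ↦ ?_⟩
    · have : Subsingleton (Localization.AtPrime q.asIdeal ⊗[B] N) :=
        subsingleton_of_forall_eq 0 fun y ↦ by
          induction y with
          | zero => rfl
          | tmul x n => rw [Subsingleton.elim n 0, TensorProduct.tmul_zero]
          | add x y hx hy => rw [hx, hy, add_zero]
      simp [Module.length_eq_zero]
    · have : (Algebra.lsmul k k N b : N →ₗ[k] N) = 0 := Subsingleton.elim _ _
      rw [this]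
      simp
  | quotient N p e =>
    intro _ _
    have hp : p.asIdeal.IsMaximal := inferInstance
    refine ⟨Pi.single ⟨p.asIdeal, hp⟩ 1, fun q ↦ ?_, fun b ↦ ?_⟩
    · by_cases hq : q = ⟨p.asIdeal, hp⟩
      · subst hq
        rw [length_localization_tensor_of_equiv_quotient_self _ e, Pi.single_eq_same,
          Module.length_eq_finrank]
        simp
      · have := subsingleton_localization_tensor_of_equiv_quotient (q := q.asIdeal)
          (fun h ↦ hq (MaximalSpectrum.ext h.symm)) e
        rw [Pi.single_eq_of_ne hq, Module.length_eq_zero]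
        simp
    · rw [Finset.sum_eq_single ⟨p.asIdeal, hp⟩ (fun q _ hq ↦ by simp [Pi.single_eq_of_ne hq])
        (by simp), Pi.single_eq_same, Nat.cast_one, one_mul]
      exact trace_lsmul_of_equiv_quotient e b
  | exact N₁ N₂ N₃ f g hf hg hfg h₁ h₃ =>
    intro _ _
    let _ : Module k N₁ := Module.compHom N₁ (algebraMap k B)
    let _ : Module k N₃ := Module.compHom N₃ (algebraMap k B)
    have : IsScalarTower k B N₁ := .of_algebraMap_smul fun _ _ ↦ rfl
    have : IsScalarTower k B N₃ := .of_algebraMap_smul fun _ _ ↦ rfl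
    have : Module.Finite k N₁ := .trans B N₁
    have : Module.Finite k N₂ := .trans B N₂
    have : Module.Finite k N₃ := .trans B N₃
    obtain ⟨c₁, hc₁, ht₁⟩ := h₁
    obtain ⟨c₃, hc₃, ht₃⟩ := h₃
    refine ⟨c₁ + c₃, fun q ↦ ?_, fun b ↦ ?_⟩
    · rw [Module.length_eq_add_of_exact
        ((f.lTensor (Localization.AtPrime q.asIdeal)).restrictScalars k)
        ((g.lTensor (Localization.AtPrime q.asIdeal)).restrictScalars k)
        (Module.Flat.lTensor_preserves_injective_linearMap f hf)
        (LinearMap.lTensor_surjective _ hg) (lTensor_exact _ hfg hg), hc₁, hc₃]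
      simp [add_mul]
    · rw [trace_eq_add_of_exact (f.restrictScalars k) (g.restrictScalars k) hf hg hfg
        (Algebra.lsmul k k N₁ b) (Algebra.lsmul k k N₂ b) (Algebra.lsmul k k N₃ b)
        (by ext; simp) (by ext; simp), ht₁, ht₃, ← Finset.sum_add_distrib]
      simp [add_mul]

variable (k B) in
/-- The trace of multiplication on a finite `k`-algebra is the sum of the traces of the
residue fields, weighted by the lengths of the local rings. -/
theorem exists_multiplicity_trace_eq_sum : ∃ c : MaximalSpectrum B → ℕ,
    (∀ q, Module.finrank k (Localization.AtPrime q.asIdeal) =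
      c q * Module.finrank k (B ⧸ q.asIdeal)) ∧
    ∀ b, Algebra.trace k B b =
      ∑ q, (c q : k) * Algebra.trace k (B ⧸ q.asIdeal) (Ideal.Quotient.mk _ b) := by
  have hart : IsArtinianRing B := isArtinian_of_tower k inferInstance
  obtain ⟨c, hc, hc'⟩ := exists_multiplicity_trace_lsmul_eq_sum k B (Module.Finite.self B)
  refine ⟨c, fun q ↦ ?_, fun b ↦ ?_⟩
  · have : Module.Finite k (Localization.AtPrime q.asIdeal) :=
      .of_surjective (Algebra.linearMap B (Localization.AtPrime q.asIdeal) |>.restrictScalars k)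
        (IsArtinianRing.localization_surjective q.asIdeal.primeCompl _)
    have := hc q
    rw [((TensorProduct.rid B (Localization.AtPrime q.asIdeal)).restrictScalars k).length_eq,
      Module.length_eq_finrank] at this
    exact_mod_cast this
  · rw [← hc']; rfl

end TraceFormula

/-! ### Rank of the trace form and embeddings of residue fields -/

section RankTraceForm

variable {k : Type*} [Field k]

lemma card_algHom_eq_finrank_of_isSeparable {L : Type*} [CommRing L] [Algebra k L]
    (hL : IsField L) [Algebra.IsSeparable k L] :
    Nat.card (L →ₐ[k] AlgebraicClosure k) = Module.finrank k L := by
  let _ := hL.toField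
  rw [← Field.finSepDegree_eq_of_isAlgClosed, Field.finSepDegree_eq_finrank_of_isSeparable]

lemma card_algHom_pos {L : Type*} [CommRing L] [Algebra k L]
    (hL : IsField L) [Module.Finite k L] : 0 < Nat.card (L →ₐ[k] AlgebraicClosure k) := by
  let _ := hL.toField
  have : Nonempty (L →ₐ[k] AlgebraicClosure k) := ⟨IsAlgClosed.lift⟩
  exact Nat.card_pos

lemma trace_eq_zero_of_not_isSeparable {L : Type*} [CommRing L] [Algebra k L]
    (hL : IsField L) (h : ¬ Algebra.IsSeparable k L) : Algebra.trace k L = 0 := by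
  let _ := hL.toField
  exact Algebra.trace_eq_zero_of_not_isSeparable h

lemma eq_zero_of_trace_mul_eq_zero {L : Type*} [CommRing L] [Algebra k L]
    (hL : IsField L) [Module.Finite k L] [Algebra.IsSeparable k L] {x : L}
    (h : ∀ y, Algebra.trace k L (x * y) = 0) : x = 0 := by
  let _ := hL.toField
  exact (traceForm_nondegenerate k L).1 x h

lemma isField_quotient {B : Type*} [CommRing B] (q : MaximalSpectrum B) :
    IsField (B ⧸ q.asIdeal) :=
  (Ideal.Quotient.maximal_ideal_iff_isField_quotient _).1 q.isMaximal

variable {B : Type*} [CommRing B] [Algebra k B]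

variable (k) in
/-- The reduction of `B` modulo a family of maximal ideals. -/
def residueMap (S : Finset (MaximalSpectrum B)) :
    B →ₗ[k] Π q : S, B ⧸ q.1.asIdeal :=
  LinearMap.pi fun q ↦ (Ideal.Quotient.mkₐ k q.1.asIdeal).toLinearMap

lemma mem_ker_residueMap {S : Finset (MaximalSpectrum B)} {b : B} :
    b ∈ LinearMap.ker (residueMap k S) ↔ ∀ q ∈ S, b ∈ q.asIdeal := by
  simp only [LinearMap.mem_ker, residueMap, funext_iff, LinearMap.pi_apply]
  refine ⟨fun h q hq ↦ Ideal.Quotient.eq_zero_iff_mem.1 (h ⟨q, hq⟩), fun h q ↦ ?_⟩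
  exact Ideal.Quotient.eq_zero_iff_mem.2 (h q.1 q.2)

lemma pairwise_isCoprime_asIdeal (S : Finset (MaximalSpectrum B)) :
    Pairwise (Function.onFun IsCoprime fun q : S ↦ q.1.asIdeal) :=
  fun _ _ h ↦ MaximalSpectrum.isCoprime_of_ne fun h' ↦ h (Subtype.ext h')

lemma residueMap_surjective (S : Finset (MaximalSpectrum B)) :
    Function.Surjective (residueMap k S) := fun z ↦ by
  obtain ⟨b, hb⟩ := Ideal.pi_quotient_surjective (pairwise_isCoprime_asIdeal S) z
  exact ⟨b, funext hb⟩

lemma finrank_range_le_of_ker_le {V W W' : Type*} [AddCommGroup V] [AddCommGroup W]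
    [AddCommGroup W'] [Module k V] [Module k W] [Module k W'] [Module.Finite k V]
    (f : V →ₗ[k] W) (g : V →ₗ[k] W') (h : LinearMap.ker f ≤ LinearMap.ker g) :
    Module.finrank k (LinearMap.range g) ≤ Module.finrank k (LinearMap.range f) := by
  have := f.finrank_range_add_finrank_ker
  have := g.finrank_range_add_finrank_ker
  have := Submodule.finrank_mono h
  lia

variable [Module.Finite k B]

lemma finrank_range_residueMap (S : Finset (MaximalSpectrum B)) :
    Module.finrank k (LinearMap.range (residueMap k S)) =
      ∑ q ∈ S, Module.finrank k (B ⧸ q.asIdeal) := by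
  rw [LinearMap.range_eq_top.2 (residueMap_surjective S), finrank_top, Module.finrank_pi_fintype]
  exact Finset.sum_coe_sort S fun q ↦ Module.finrank k (B ⧸ q.asIdeal)

variable [Fintype (MaximalSpectrum B)] {c : MaximalSpectrum B → ℕ} (hc : ∀ b, Algebra.trace k B b =
  ∑ q, (c q : k) * Algebra.trace k (B ⧸ q.asIdeal) (Ideal.Quotient.mk _ b))

include hc

lemma finrank_range_traceForm_le_sum_filter [DecidablePred fun q : MaximalSpectrum B ↦
      (c q : k) ≠ 0 ∧ Algebra.IsSeparable k (B ⧸ q.asIdeal)] :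
    Module.finrank k (LinearMap.range (Algebra.traceForm k B)) ≤
      ∑ q with (c q : k) ≠ 0 ∧ Algebra.IsSeparable k (B ⧸ q.asIdeal),
        Nat.card (B ⧸ q.asIdeal →ₐ[k] AlgebraicClosure k) := by
  set S : Finset (MaximalSpectrum B) :=
    {q | (c q : k) ≠ 0 ∧ Algebra.IsSeparable k (B ⧸ q.asIdeal)} with hS
  have hcard : ∑ q ∈ S, Nat.card (B ⧸ q.asIdeal →ₐ[k] AlgebraicClosure k) =
      ∑ q ∈ S, Module.finrank k (B ⧸ q.asIdeal) := by
    refine Finset.sum_congr rfl fun q hq ↦ ?_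
    have := (Finset.mem_filter.1 hq).2.2
    exact card_algHom_eq_finrank_of_isSeparable (isField_quotient q)
  rw [hcard, ← finrank_range_residueMap]
  refine finrank_range_le_of_ker_le _ _ fun b hb ↦ ?_
  rw [mem_ker_residueMap] at hb
  rw [LinearMap.mem_ker]
  ext b'
  rw [Algebra.traceForm_apply, hc, LinearMap.zero_apply]
  refine Finset.sum_eq_zero fun q _ ↦ ?_
  by_cases hq : q ∈ S
  · rw [map_mul, Ideal.Quotient.eq_zero_iff_mem.2 (hb q hq), zero_mul, map_zero, mul_zero]
  · have : (c q : k) = 0 ∨ ¬ Algebra.IsSeparable k (B ⧸ q.asIdeal) := by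
      simpa [hS, or_iff_not_imp_left] using hq
    obtain h | h := this
    · rw [h, zero_mul]
    · rw [trace_eq_zero_of_not_isSeparable (isField_quotient q) h, LinearMap.zero_apply, mul_zero]

lemma ker_traceForm_eq_of_tame
    (h : ∀ q, (c q : k) ≠ 0 ∧ Algebra.IsSeparable k (B ⧸ q.asIdeal)) {b : B} :
    (∀ b', Algebra.trace k B (b * b') = 0) ↔ ∀ q : MaximalSpectrum B, b ∈ q.asIdeal := by
  classical
  refine ⟨fun hb q ↦ ?_, fun hb b' ↦ ?_⟩
  · have := (h q).2
    refine Ideal.Quotient.eq_zero_iff_mem.1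
      -- A lift `b'` of `y` at `q` and of `0` at all other maximal ideals isolates the summand of
      -- `q`; nondegeneracy of the separable trace concludes.
      (eq_zero_of_trace_mul_eq_zero (k := k) (isField_quotient q) fun y ↦ ?_)
    obtain ⟨b', hb'⟩ := Ideal.pi_quotient_surjective
      (I := fun q : MaximalSpectrum B ↦ q.asIdeal)
      (fun _ _ h ↦ MaximalSpectrum.isCoprime_of_ne h) (Pi.single q y)
    have := hb b'
    rw [hc, Finset.sum_eq_single q (fun q' _ hq' ↦ by
      rw [map_mul, hb', Pi.single_eq_of_ne hq', mul_zero, map_zero, mul_zero]) (by simp),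
      map_mul, hb', Pi.single_eq_same] at this
    exact (mul_eq_zero.1 this).resolve_left (h q).1
  · rw [hc]
    refine Finset.sum_eq_zero fun q _ ↦ ?_
    rw [map_mul, Ideal.Quotient.eq_zero_iff_mem.2 (hb q), zero_mul, map_zero, mul_zero]

theorem finrank_range_traceForm_le :
    Module.finrank k (LinearMap.range (Algebra.traceForm k B)) ≤
      ∑ q : MaximalSpectrum B, Nat.card (B ⧸ q.asIdeal →ₐ[k] AlgebraicClosure k) := by
  classical
  exact (finrank_range_traceForm_le_sum_filter hc).trans
    (Finset.sum_le_sum_of_subset (Finset.filter_subset _ _))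

theorem finrank_range_traceForm_eq_iff :
    Module.finrank k (LinearMap.range (Algebra.traceForm k B)) =
      ∑ q : MaximalSpectrum B, Nat.card (B ⧸ q.asIdeal →ₐ[k] AlgebraicClosure k) ↔
    ∀ q, (c q : k) ≠ 0 ∧ Algebra.IsSeparable k (B ⧸ q.asIdeal) := by
  classical
  refine ⟨fun h q ↦ ?_, fun h ↦ (finrank_range_traceForm_le hc).antisymm ?_⟩
  · by_contra hq
    have h1 := finrank_range_traceForm_le_sum_filter hc
    -- An excluded `q` still has at least one embedding, so it makes the bound strict.
    have h2 := Finset.sum_lt_sum_of_subset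
      (f := fun q : MaximalSpectrum B ↦ Nat.card (B ⧸ q.asIdeal →ₐ[k] AlgebraicClosure k))
      (Finset.filter_subset (fun q ↦ (c q : k) ≠ 0 ∧ Algebra.IsSeparable k (B ⧸ q.asIdeal))
        Finset.univ) (Finset.mem_univ q) (by simpa using hq)
      (card_algHom_pos (isField_quotient q)) (fun _ _ _ ↦ Nat.zero_le _)
    lia
  · have hcard : ∑ q : MaximalSpectrum B, Nat.card (B ⧸ q.asIdeal →ₐ[k] AlgebraicClosure k) =
        ∑ q : MaximalSpectrum B, Module.finrank k (B ⧸ q.asIdeal) := by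
      refine Finset.sum_congr rfl fun q _ ↦ ?_
      have := (h q).2
      exact card_algHom_eq_finrank_of_isSeparable (isField_quotient q)
    rw [hcard, ← finrank_range_residueMap]
    refine finrank_range_le_of_ker_le _ _ fun b hb ↦ ?_
    rw [mem_ker_residueMap]
    exact fun q _ ↦ (ker_traceForm_eq_of_tame hc h).1 (fun b' ↦ LinearMap.congr_fun hb b') q

end RankTraceForm

/-! ### Geometric points as embeddings of residue fields -/

section GeometricPoints

/-- The points of a finite algebra over an algebraically closed field are rational. -/
lemma bijective_ker_algHom (Ω C : Type*) [Field Ω] [IsAlgClosed Ω] [CommRing C] [Algebra Ω C]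
    [Module.Finite Ω C] : Function.Bijective
      (fun f : C →ₐ[Ω] Ω ↦ (⟨RingHom.ker f, RingHom.ker_isPrime f⟩ : PrimeSpectrum C)) := by
  refine ⟨fun f g h ↦ AlgHom.ext fun c ↦ ?_, fun P ↦ ?_⟩
  · have hk : RingHom.ker f = RingHom.ker g := congrArg PrimeSpectrum.asIdeal h
    have : c - algebraMap Ω C (f c) ∈ RingHom.ker f := by simp [RingHom.mem_ker]
    rw [hk, RingHom.mem_ker, map_sub, AlgHom.commutes, sub_eq_zero] at this
    exact this.symm
  · have hb := IsAlgClosed.algebraMap_bijective_of_isIntegral (k := Ω) (K := C ⧸ P.asIdeal)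
    refine ⟨(AlgEquiv.ofBijective (Algebra.ofId Ω (C ⧸ P.asIdeal)) hb).symm.toAlgHom.comp
      (Ideal.Quotient.mkₐ Ω P.asIdeal), PrimeSpectrum.ext (Ideal.ext fun c ↦ ?_)⟩
    rw [RingHom.mem_ker]
    change (AlgEquiv.ofBijective (Algebra.ofId Ω (C ⧸ P.asIdeal)) hb).symm
      (Ideal.Quotient.mk P.asIdeal c) = 0 ↔ _
    rw [EmbeddingLike.map_eq_zero_iff, Ideal.Quotient.eq_zero_iff_mem]

lemma bijective_sigma_algHom_comp_mk (k B Ω : Type*) [Field k] [CommRing B] [Algebra k B]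
    [Module.Finite k B] [Field Ω] [Algebra k Ω] : Function.Bijective
      (fun f : Σ q : MaximalSpectrum B, (B ⧸ q.asIdeal →ₐ[k] Ω) ↦
        f.2.comp (Ideal.Quotient.mkₐ k f.1.asIdeal)) := by
  have hart : IsArtinianRing B := isArtinian_of_tower k inferInstance
  have hker (q : MaximalSpectrum B) (f : B ⧸ q.asIdeal →ₐ[k] Ω) :
      RingHom.ker (f.comp (Ideal.Quotient.mkₐ k q.asIdeal)) = q.asIdeal :=
    (q.isMaximal.eq_of_le (RingHom.ker_ne_top _) fun b hb ↦ by
      rw [RingHom.mem_ker, AlgHom.comp_apply, Ideal.Quotient.mkₐ_eq_mk,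
        Ideal.Quotient.eq_zero_iff_mem.2 hb, map_zero]).symm
  refine ⟨fun ⟨q, f⟩ ⟨q', f'⟩ h ↦ ?_, fun f ↦ ?_⟩
  · obtain rfl : q = q' := MaximalSpectrum.ext <| by
      rw [← hker q f, ← hker q' f']
      exact congrArg RingHom.ker h
    congr 1
    exact AlgHom.ext fun x ↦ by
      obtain ⟨b, rfl⟩ := Ideal.Quotient.mk_surjective x
      exact AlgHom.congr_fun h b
  · have : (RingHom.ker f).IsPrime := RingHom.ker_isPrime f
    exact ⟨⟨⟨RingHom.ker f, inferInstance⟩, Ideal.kerLiftAlg f⟩, AlgHom.ext fun b ↦ rfl⟩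

lemma finite_algHom_of_isField {k L Ω : Type*} [Field k] [CommRing L] [Algebra k L]
    (hL : IsField L) [Module.Finite k L] [Field Ω] [Algebra k Ω] : Finite (L →ₐ[k] Ω) := by
  let _ := hL.toField
  infer_instance

variable (R : Type*) [CommRing R] [IsLocalRing R] (A : Type*) [CommRing A] [Algebra R A]
  [Module.Finite R A]

theorem geometricPoints_eq_sum {B : Type*} [CommRing B] [Algebra (IsLocalRing.ResidueField R) B]
    [Module.Finite (IsLocalRing.ResidueField R) B] [Fintype (MaximalSpectrum B)]
    (e : IsLocalRing.ResidueField R ⊗[R] A ≃ₐ[IsLocalRing.ResidueField R] B) :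
    geometricPoints R A = (∑ q : MaximalSpectrum B, Nat.card
      (B ⧸ q.asIdeal →ₐ[IsLocalRing.ResidueField R]
        AlgebraicClosure (IsLocalRing.ResidueField R)) : ℕ) := by
  set k := IsLocalRing.ResidueField R
  set Ω := AlgebraicClosure k
  have e₁ : PrimeSpectrum (A ⊗[R] Ω) ≃ PrimeSpectrum (Ω ⊗[R] A) :=
    (PrimeSpectrum.comapEquiv (Algebra.TensorProduct.comm R A Ω).toRingEquiv).toEquiv
  have e₂ : (Ω ⊗[R] A →ₐ[Ω] Ω) ≃ PrimeSpectrum (Ω ⊗[R] A) :=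
    .ofBijective _ (bijective_ker_algHom Ω (Ω ⊗[R] A))
  have e₃ : (Σ q : MaximalSpectrum B, (B ⧸ q.asIdeal →ₐ[k] Ω)) ≃ (B →ₐ[k] Ω) :=
    .ofBijective _ (bijective_sigma_algHom_comp_mk k B Ω)
  -- Both sides are the `R`-algebra maps from `A` to `Ω`.
  have e₄ : (B →ₐ[k] Ω) ≃ (Ω ⊗[R] A →ₐ[Ω] Ω) :=
    (e.symm.arrowCongr AlgEquiv.refl).trans
      ((Algebra.TensorProduct.liftEquivRight R k A Ω).symm.trans
        (Algebra.TensorProduct.liftEquivRight R Ω A Ω))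
  have (q : MaximalSpectrum B) : Finite (B ⧸ q.asIdeal →ₐ[k] Ω) :=
    finite_algHom_of_isField (isField_quotient q)
  rw [geometricPoints, ENat.card_congr (e₁.trans (e₂.symm.trans (e₄.symm.trans e₃.symm))),
    ENat.card_eq_coe_natCard, Nat.card_sigma]

end GeometricPoints

/-! ### Maximal ideals and localizations of the special fibre -/

section SpecialFibre

variable {R : Type*} [CommRing R] {k : Type*} [Field k] [Algebra R k]
  {A : Type*} [CommRing A] [Algebra R A]
  {B : Type*} [CommRing B] [Algebra k B] [Algebra A B] [Algebra R B] [IsScalarTower R k B]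
  [IsScalarTower R A B] [Algebra.IsPushout R k A B]

lemma ker_algebraMap_le_of_isScalarTower (p : Ideal A) [Algebra k (A ⧸ p)]
    [IsScalarTower R k (A ⧸ p)] : RingHom.ker (algebraMap A B) ≤ p := fun a ha ↦ by
  let φ : k ⊗[R] A →ₐ[k] A ⧸ p :=
    Algebra.TensorProduct.lift (Algebra.ofId k _) (Ideal.Quotient.mkₐ R p) fun _ _ ↦ .all _ _
  have h : (1 : k) ⊗ₜ[R] a = 0 := by
    rw [← Algebra.IsPushout.equiv_symm_algebraMap_right R k A B a,
      RingHom.mem_ker.1 ha, map_zero]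
  have h' : φ ((1 : k) ⊗ₜ[R] a) = Ideal.Quotient.mk p a := by simp [φ]
  rw [h, map_zero] at h'
  exact Ideal.Quotient.eq_zero_iff_mem.1 h'.symm

variable (hk : Function.Surjective (algebraMap R k))

include hk

lemma algebraMap_surjective_of_isPushout : Function.Surjective (algebraMap A B) := fun b ↦ by
  obtain ⟨x, rfl⟩ := (Algebra.IsPushout.equiv R k A B).surjective b
  induction x with
  | zero => exact ⟨0, by simp⟩
  | tmul c a =>
    obtain ⟨r, rfl⟩ := hk c
    refine ⟨algebraMap R A r * a, ?_⟩
    rw [Algebra.IsPushout.equiv_tmul, map_mul, ← IsScalarTower.algebraMap_apply,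
      ← IsScalarTower.algebraMap_apply]
  | add x y hx hy =>
    obtain ⟨a, ha⟩ := hx
    obtain ⟨a', ha'⟩ := hy
    exact ⟨a + a', by rw [map_add, map_add, ha, ha']⟩

/-- As `A → B` is surjective, the complement of `p` maps onto that of `q`, so `B_q` is the base
change of `A_p`. -/
lemma finrank_tensor_localization_eq (p : Ideal A) [p.IsPrime] (q : Ideal B) [q.IsPrime]
    (hpq : q.under A = p) :
    Module.finrank k (k ⊗[R] Localization.AtPrime p) =
      Module.finrank k (Localization.AtPrime q) := by
  have hsub : Algebra.algebraMapSubmonoid B p.primeCompl = q.primeCompl := by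
    ext b
    obtain ⟨a, rfl⟩ := algebraMap_surjective_of_isPushout (R := R) (A := A) hk b
    refine ⟨?_, fun h ↦ ⟨a, fun ha ↦ h ?_, rfl⟩⟩
    · rintro ⟨a', ha', h⟩
      rw [← h]
      exact fun h' ↦ ha' (hpq ▸ h')
    · rw [SetLike.mem_coe, ← hpq] at ha
      exact ha
  have : IsLocalization (Algebra.algebraMapSubmonoid B p.primeCompl)
      (Localization.AtPrime q) := by rw [hsub]; infer_instance
  let e₁ : k ⊗[R] Localization.AtPrime p ≃ₗ[R] B ⊗[A] Localization.AtPrime p :=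
    (Algebra.IsPushout.cancelBaseChange R k A B (Localization.AtPrime p)).symm.restrictScalars R
  let e₂ : B ⊗[A] Localization.AtPrime p ≃ₗ[A] Localization.AtPrime p ⊗[A] B :=
    TensorProduct.comm A _ _
  let e₃ : Localization.AtPrime p ⊗[A] B ≃ₗ[A] Localization.AtPrime q :=
    IsLocalizedModule.linearEquiv p.primeCompl
      (TensorProduct.mk A (Localization.AtPrime p) B 1)
      (IsScalarTower.toAlgHom A B (Localization.AtPrime q)).toLinearMap
  exact (LinearEquiv.extendScalarsOfSurjective hk
    (e₁.trans ((e₂.trans e₃).restrictScalars R))).finrank_eq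

/-- The maximal ideal of the special fibre corresponding to a maximal ideal of `A`. -/
lemma exists_maximalSpectrum_under_eq (p : Ideal A) [p.IsMaximal] [Algebra k (A ⧸ p)]
    [IsScalarTower R k (A ⧸ p)] : ∃ q : MaximalSpectrum B, q.asIdeal.under A = p := by
  have hs := algebraMap_surjective_of_isPushout (R := R) (A := A) (B := B) hk
  have hle := ker_algebraMap_le_of_isScalarTower (R := R) (k := k) (B := B) p
  have hmax : (p.map (algebraMap A B)).IsMaximal :=
    (Ideal.map_eq_top_or_isMaximal_of_surjective _ hs ‹_›).resolve_left fun h ↦ by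
      have := Ideal.comap_map_of_surjective' _ hs p
      rw [h, Ideal.comap_top, sup_eq_left.2 hle] at this
      exact Ideal.IsMaximal.ne_top ‹_› this.symm
  refine ⟨⟨_, hmax⟩, ?_⟩
  rw [Ideal.under, Ideal.comap_map_of_surjective' _ hs, sup_eq_left.2 hle]

lemma nonempty_algEquiv_quotient (p : Ideal A) (q : Ideal B) (hpq : q.under A = p)
    [Algebra k (A ⧸ p)] [IsScalarTower R k (A ⧸ p)] : Nonempty ((A ⧸ p) ≃ₐ[k] B ⧸ q) := by
  have hs := algebraMap_surjective_of_isPushout (R := R) (A := A) (B := B) hk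
  let f : A →ₐ[R] B ⧸ q := (Ideal.Quotient.mkₐ R q).comp (IsScalarTower.toAlgHom R A B)
  have hf : Function.Surjective f := Ideal.Quotient.mk_surjective.comp hs
  have hker : RingHom.ker f = p := by
    rw [← hpq]
    ext a
    exact Ideal.Quotient.eq_zero_iff_mem
  exact ⟨((Ideal.quotientEquivAlgOfEq R hker.symm).trans
    (Ideal.quotientKerAlgEquivOfSurjective hf)).extendScalarsOfSurjective hk⟩

end SpecialFibre

open IsLocalRing

/-! ### Tameness and separability read off the special fibre -/

section Dictionary

variable {R : Type*} [CommRing R] [IsLocalRing R] {A : Type*} [CommRing A] [Algebra R A]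
  {B : Type*} [CommRing B] [Algebra (ResidueField R) B] [Algebra A B]
  [Algebra R B] [IsScalarTower R (ResidueField R) B] [IsScalarTower R A B]
  [Algebra.IsPushout R (ResidueField R) A B]

lemma liesOver_of_isMaximal [Module.Finite R A] (p : Ideal A) [p.IsMaximal] :
    p.LiesOver (maximalIdeal R) :=
  ⟨(IsLocalRing.eq_maximalIdeal (Ideal.isMaximal_comap_of_isIntegral_of_isMaximal p)).symm⟩

lemma natCast_ne_zero_iff_coprime_ringChar {k : Type*} [Field k] {n : ℕ} (hn : n ≠ 0) :
    (n : k) ≠ 0 ↔ ringChar k = 0 ∨ n.Coprime (ringChar k) := by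
  rw [Ne, ringChar.spec]
  obtain h | h := CharP.char_is_prime_or_zero k (ringChar k)
  · rw [Nat.coprime_comm, h.coprime_iff_not_dvd]
    exact ⟨.inr, fun h' ↦ h'.resolve_left h.ne_zero⟩
  · simp [h, hn]

variable (R) in
lemma ramificationIndex_eq {p : Ideal A} [p.IsMaximal] [p.LiesOver (maximalIdeal R)]
    [Module.Finite (ResidueField R) B] {q : Ideal B} [q.IsMaximal] (hpq : q.under A = p) {c : ℕ}
    (hc : Module.finrank (ResidueField R) (Localization.AtPrime q) =
      c * Module.finrank (ResidueField R) (B ⧸ q)) :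
    ramificationIndex R p = c := by
  let _ : Algebra (ResidueField R) (A ⧸ p) :=
    inferInstanceAs (Algebra (R ⧸ maximalIdeal R) (A ⧸ p))
  have : IsScalarTower R (ResidueField R) (A ⧸ p) :=
    inferInstanceAs (IsScalarTower R (R ⧸ maximalIdeal R) (A ⧸ p))
  obtain ⟨e⟩ := nonempty_algEquiv_quotient (k := ResidueField R) (R := R) residue_surjective p q hpq
  have h1 := finrank_tensor_localization_eq (k := ResidueField R) (R := R) residue_surjective p q hpq
  have hpos : 0 < Module.finrank (ResidueField R) (B ⧸ q) :=
    have : Nontrivial (B ⧸ q) := Ideal.Quotient.nontrivial_iff.2 (Ideal.IsMaximal.ne_top ‹_›)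
    Module.finrank_pos
  calc
    ramificationIndex R p = Module.finrank (ResidueField R)
      (ResidueField R ⊗[R] Localization.AtPrime p) / Module.finrank (ResidueField R) (A ⧸ p) := rfl
    _ = c := by rw [h1, e.toLinearEquiv.finrank_eq, hc, Nat.mul_div_cancel _ hpos]

lemma isSeparable_quotient_iff {p : Ideal A} [p.IsMaximal] [p.LiesOver (maximalIdeal R)]
    {q : Ideal B} (hpq : q.under A = p) :
    Algebra.IsSeparable (R ⧸ maximalIdeal R) (A ⧸ p) ↔
      Algebra.IsSeparable (ResidueField R) (B ⧸ q) := by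
  let _ : Algebra (ResidueField R) (A ⧸ p) :=
    inferInstanceAs (Algebra (R ⧸ maximalIdeal R) (A ⧸ p))
  have : IsScalarTower R (ResidueField R) (A ⧸ p) :=
    inferInstanceAs (IsScalarTower R (R ⧸ maximalIdeal R) (A ⧸ p))
  obtain ⟨e⟩ := nonempty_algEquiv_quotient (k := ResidueField R) (R := R) residue_surjective p q hpq
  change Algebra.IsSeparable (ResidueField R) (A ⧸ p) ↔ _
  exact AlgEquiv.Algebra.isSeparable_iff e

theorem isTame_and_hasSeparableResidueFields_iff [Module.Finite R A]
    [Module.Finite (ResidueField R) B]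
    {c : MaximalSpectrum B → ℕ}
    (hc : ∀ q, Module.finrank (ResidueField R) (Localization.AtPrime q.asIdeal) =
      c q * Module.finrank (ResidueField R) (B ⧸ q.asIdeal)) :
    IsTame R A ∧ HasSeparableResidueFields R A ↔
      ∀ q, (c q : ResidueField R) ≠ 0 ∧
        Algebra.IsSeparable (ResidueField R) (B ⧸ q.asIdeal) := by
  have hart : IsArtinianRing B := isArtinian_of_tower (ResidueField R) inferInstance
  -- In residue characteristic zero tameness is no condition, so `c q ≠ 0` in `k` must come from
  -- `B_q ≠ 0`.
  have hc0 (q : MaximalSpectrum B) : c q ≠ 0 := fun h ↦ by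
    have : Module.Finite (ResidueField R) (Localization.AtPrime q.asIdeal) :=
      .of_surjective (Algebra.linearMap B (Localization.AtPrime q.asIdeal) |>.restrictScalars _)
        (IsArtinianRing.localization_surjective q.asIdeal.primeCompl _)
    have := hc q
    rw [h, zero_mul] at this
    exact Module.finrank_pos.ne' this
  refine ⟨fun ⟨ht, hs⟩ q ↦ ?_, fun h ↦ ⟨fun p _ _ ↦ ?_, fun p _ _ ↦ ?_⟩⟩
  · have hmax : (q.asIdeal.under A).IsMaximal := Ideal.comap_isMaximal_of_surjective _
      (algebraMap_surjective_of_isPushout (R := R) (k := ResidueField R) residue_surjective)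
    have := liesOver_of_isMaximal (R := R) (q.asIdeal.under A)
    rw [natCast_ne_zero_iff_coprime_ringChar (hc0 q),
      ← isSeparable_quotient_iff (p := q.asIdeal.under A) rfl,
      ← ramificationIndex_eq R (p := q.asIdeal.under A) rfl (hc q)]
    exact ⟨ht _, hs _⟩
  all_goals
    let _ : Algebra (ResidueField R) (A ⧸ p) :=
      inferInstanceAs (Algebra (R ⧸ maximalIdeal R) (A ⧸ p))
    have : IsScalarTower R (ResidueField R) (A ⧸ p) :=
      inferInstanceAs (IsScalarTower R (R ⧸ maximalIdeal R) (A ⧸ p))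
    obtain ⟨q, hq⟩ := exists_maximalSpectrum_under_eq (R := R) (k := ResidueField R) (B := B)
      residue_surjective p
  · rw [ramificationIndex_eq R hq (hc q), ← natCast_ne_zero_iff_coprime_ringChar (hc0 q)]
    exact (h q).1
  · exact (isSeparable_quotient_iff hq).2 (h q).2

end Dictionary

/-! ### Linear forms and the trace cokernel modulo the maximal ideal -/

noncomputable section

lemma exists_smul_eq_of_forall_dvd {R M : Type*} [CommRing R] [IsDomain R] [AddCommGroup M]
    [Module R M] {π : R} (hπ : π ≠ 0) (φ : Module.Dual R M) (h : ∀ a, π ∣ φ a) :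
    ∃ ψ : Module.Dual R M, π • ψ = φ := by
  choose f hf using h
  refine ⟨⟨⟨f, fun x y ↦ mul_left_cancel₀ hπ ?_⟩, fun r x ↦ mul_left_cancel₀ hπ ?_⟩,
    LinearMap.ext fun a ↦ (hf a).symm⟩
  · rw [← hf, map_add, hf x, hf y, mul_add]
  · simp only [RingHom.id_apply, smul_eq_mul]
    rw [← hf, map_smul, hf x, smul_eq_mul, mul_left_comm]

lemma algebraMap_fibre_surjective (R : Type*) [CommRing R] [IsLocalRing R] (A : Type*)
    [CommRing A] [Algebra R A] (B : Type*) [CommRing B] [Algebra (ResidueField R) B] [Algebra A B]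
    [Algebra R B] [IsScalarTower R (ResidueField R) B] [IsScalarTower R A B]
    [Algebra.IsPushout R (ResidueField R) A B] : Function.Surjective (algebraMap A B) :=
  algebraMap_surjective_of_isPushout (R := R) (k := ResidueField R) residue_surjective

lemma moduleFinite_fibre (R : Type*) [CommRing R] [IsLocalRing R] (A : Type*)
    [CommRing A] [Algebra R A] (B : Type*) [CommRing B] [Algebra (ResidueField R) B] [Algebra A B]
    [Algebra R B] [IsScalarTower R (ResidueField R) B] [IsScalarTower R A B]
    [Algebra.IsPushout R (ResidueField R) A B] [Module.Finite R A] :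
    Module.Finite (ResidueField R) B :=
  .equiv (Algebra.IsPushout.equiv R (ResidueField R) A B).toLinearEquiv

section Fibre

variable {R : Type*} [CommRing R] [IsLocalRing R] {A : Type*} [CommRing A] [Algebra R A]
  (B : Type*) [CommRing B] [Algebra (ResidueField R) B] [Algebra A B]
  [Algebra R B] [IsScalarTower R (ResidueField R) B] [IsScalarTower R A B]
  [Algebra.IsPushout R (ResidueField R) A B]

lemma trace_algebraMap_of_isPushout [Module.Finite R A] [Module.Free R A] (a : A) :
    Algebra.trace (ResidueField R) B (algebraMap A B a) = residue R (Algebra.trace R A a) := by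
  rw [← Algebra.trace_eq_of_algEquiv (Algebra.IsPushout.equiv R (ResidueField R) A B).symm,
    Algebra.IsPushout.equiv_symm_algebraMap_right, Algebra.trace_apply, Algebra.trace_apply]
  rw [← ResidueField.algebraMap_eq, ← LinearMap.trace_baseChange]
  congr 1
  ext
  simp

/-- Reduction of linear forms to the special fibre. -/
def dualReduction : Module.Dual R A →ₗ[R] Module.Dual (ResidueField R) B where
  toFun φ := (Algebra.IsPushout.out (R := R) (S := ResidueField R) (R' := A) (S' := B)).lift
    (Algebra.linearMap R (ResidueField R) ∘ₗ φ)
  map_add' φ ψ := by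
    rw [LinearMap.comp_add]
    apply (Algebra.IsPushout.out (R := R) (S := ResidueField R) (R' := A) (S' := B)).algHom_ext
    intro a
    simp only [LinearMap.add_apply, IsBaseChange.lift_eq]
  map_smul' r φ := by
    rw [LinearMap.comp_smul]
    apply (Algebra.IsPushout.out (R := R) (S := ResidueField R) (R' := A) (S' := B)).algHom_ext
    intro a
    simp only [LinearMap.smul_apply, IsBaseChange.lift_eq, RingHom.id_apply]

@[simp]
lemma dualReduction_apply_algebraMap (φ : Module.Dual R A) (a : A) :
    dualReduction B φ (algebraMap A B a) = residue R (φ a) :=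
  (Algebra.IsPushout.out (R := R) (S := ResidueField R) (R' := A) (S' := B)).lift_eq _ a

end Fibre

section Length

variable {R : Type*} [CommRing R] [IsDomain R] [IsDiscreteValuationRing R] {A : Type*}
  [CommRing A] [Algebra R A]
  (B : Type*) [CommRing B] [Algebra (ResidueField R) B] [Algebra A B]
  [Algebra R B] [IsScalarTower R (ResidueField R) B] [IsScalarTower R A B]
  [Algebra.IsPushout R (ResidueField R) A B]

lemma dualReduction_surjective [Module.Free R A] :
    Function.Surjective (dualReduction (R := R) (A := A) B) := fun ψ ↦ by
  obtain ⟨φ, hφ⟩ := Module.projective_lifting_property (Algebra.linearMap R (ResidueField R))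
    (ψ.restrictScalars R ∘ₗ (IsScalarTower.toAlgHom R A B).toLinearMap) residue_surjective
  refine ⟨φ, LinearMap.ext fun b ↦ ?_⟩
  obtain ⟨a, rfl⟩ := algebraMap_fibre_surjective R A B b
  rw [dualReduction_apply_algebraMap]
  exact LinearMap.congr_fun hφ a

lemma dualReduction_eq_zero_iff {π : R} (hπ : Irreducible π) {φ : Module.Dual R A} :
    dualReduction B φ = 0 ↔ ∃ ψ, π • ψ = φ := by
  refine ⟨fun h ↦ exists_smul_eq_of_forall_dvd hπ.ne_zero φ fun a ↦ ?_, ?_⟩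
  · have := dualReduction_apply_algebraMap B φ a
    rwa [h, LinearMap.zero_apply, eq_comm, residue_eq_zero_iff, hπ.maximalIdeal_eq,
      Ideal.mem_span_singleton] at this
  · rintro ⟨ψ, rfl⟩
    ext b
    obtain ⟨a, rfl⟩ := algebraMap_fibre_surjective R A B b
    rw [dualReduction_apply_algebraMap, LinearMap.zero_apply, residue_eq_zero_iff,
      hπ.maximalIdeal_eq, Ideal.mem_span_singleton]
    exact ⟨ψ a, rfl⟩

lemma finrank_fibre [Module.Free R A] : Module.finrank (ResidueField R) B = Module.finrank R A := by
  rw [← (Algebra.IsPushout.equiv R (ResidueField R) A B).toLinearEquiv.finrank_eq,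
    Module.finrank_baseChange]

variable [Module.Finite R A] [Module.Free R A]

lemma dualReduction_traceForm (a : A) :
    dualReduction B (Algebra.traceForm R A a) =
      Algebra.traceForm (ResidueField R) B (algebraMap A B a) := by
  ext b
  obtain ⟨a', rfl⟩ := algebraMap_fibre_surjective R A B b
  rw [dualReduction_apply_algebraMap, Algebra.traceForm_apply, Algebra.traceForm_apply, ← map_mul,
    trace_algebraMap_of_isPushout]

/-- The comparison map from the trace cokernel of `A` to that of its special fibre. -/
def traceCokernelReduction : TraceCokernel R A →ₗ[R] TraceCokernel (ResidueField R) B :=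
  Submodule.liftQ _ ((Submodule.mkQ (LinearMap.range
    (Algebra.traceForm (ResidueField R) B))).restrictScalars R ∘ₗ dualReduction B) <| by
    rintro _ ⟨a, rfl⟩
    rw [LinearMap.mem_ker, LinearMap.comp_apply, dualReduction_traceForm]
    exact (Submodule.Quotient.mk_eq_zero _).2 ⟨_, rfl⟩

lemma traceCokernelReduction_mk (φ : Module.Dual R A) :
    traceCokernelReduction B (Submodule.Quotient.mk φ : TraceCokernel R A) =
      Submodule.Quotient.mk (dualReduction B φ) := rfl

lemma traceCokernelReduction_surjective :
    Function.Surjective (traceCokernelReduction (R := R) (A := A) B) := fun y ↦ by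
  obtain ⟨ψ, rfl⟩ := Submodule.Quotient.mk_surjective _ y
  obtain ⟨φ, rfl⟩ := dualReduction_surjective (R := R) (A := A) B ψ
  exact ⟨Submodule.Quotient.mk φ, rfl⟩

/-- If `φ` reduces to the form of the image of `a`, then `φ - tr(a·)` takes values in `πR` and is
therefore `π` times a linear form. -/
lemma ker_traceCokernelReduction :
    LinearMap.ker (traceCokernelReduction (R := R) (A := A) B) =
      maximalIdeal R • (⊤ : Submodule R (TraceCokernel R A)) := by
  obtain ⟨π, hπ⟩ := IsDiscreteValuationRing.exists_irreducible R
  ext x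
  rw [hπ.maximalIdeal_eq, Submodule.ideal_span_singleton_smul,
    Submodule.mem_smul_pointwise_iff_exists]
  constructor
  · obtain ⟨φ, rfl⟩ := Submodule.Quotient.mk_surjective _ x
    intro h
    rw [LinearMap.mem_ker, traceCokernelReduction_mk, Submodule.Quotient.mk_eq_zero] at h
    obtain ⟨b, hb⟩ := h
    obtain ⟨a, rfl⟩ := algebraMap_fibre_surjective R A B b
    rw [← dualReduction_traceForm, ← sub_eq_zero, ← map_sub,
      dualReduction_eq_zero_iff B hπ] at hb
    obtain ⟨ψ, hψ⟩ := hb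
    refine ⟨Submodule.Quotient.mk (-ψ), trivial, ?_⟩
    rw [← Submodule.Quotient.mk_smul, eq_comm, Submodule.Quotient.eq, smul_neg, hψ]
    exact ⟨a, by abel⟩
  · rintro ⟨y, -, rfl⟩
    obtain ⟨φ, rfl⟩ := Submodule.Quotient.mk_surjective _ y
    rw [← Submodule.Quotient.mk_smul, LinearMap.mem_ker, traceCokernelReduction_mk,
      (dualReduction_eq_zero_iff B hπ).2 ⟨φ, rfl⟩, Submodule.Quotient.mk_zero]

/-- Additivity of length along `m_R Q → Q → Q / m_R Q`. The rank is added on the left rather than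
subtracted on the right because the lengths may be infinite. -/
theorem traceLength_add_finrank_range :
    traceLength R A +
      (Module.finrank (ResidueField R)
        (LinearMap.range (Algebra.traceForm (ResidueField R) B)) : ℕ∞) =
    Module.finrank R A +
      Module.length R (maximalIdeal R • (⊤ : Submodule R (TraceCokernel R A)) :) := by
  have := moduleFinite_fibre R A B
  have h : Module.length R (TraceCokernel (ResidueField R) B) =
      Module.finrank (ResidueField R) (TraceCokernel (ResidueField R) B) := by
    rw [Module.length_eq_of_surjective (R := ResidueField R) (S := R) residue_surjective,
      Module.length_eq_finrank]
  rw [traceLength, Module.length_eq_add_of_exact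
    (LinearMap.ker (traceCokernelReduction (R := R) (A := A) B)).subtype
    (traceCokernelReduction B) (Submodule.subtype_injective _)
    (traceCokernelReduction_surjective B) (LinearMap.exact_subtype_ker_map _),
    ker_traceCokernelReduction, h, add_assoc, add_comm]
  congr 1
  rw [← finrank_fibre (R := R) (A := A) B, ← Subspace.dual_finrank_eq (K := ResidueField R) (V := B),
    ← Submodule.finrank_quotient_add_finrank
      (LinearMap.range (Algebra.traceForm (ResidueField R) B))]
  push_cast
  rfl

end Length

end

/-! ### Noetherian local rings with principal maximal ideal -/

section PrincipalMaximalIdeal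

variable {S : Type*} [CommRing S] [IsLocalRing S] [IsNoetherianRing S] {t : S}

lemma exists_eq_pow_mul_isUnit (ht : maximalIdeal S = Ideal.span {t}) {a : S} (ha : a ≠ 0) :
    ∃ (i : ℕ) (v : S), IsUnit v ∧ a = t ^ i * v := by
  have hfin : FiniteMultiplicity t a := by
    by_contra h
    refine ha ((Submodule.mem_bot S).1 ?_)
    rw [← Ideal.iInf_pow_eq_bot_of_isLocalRing (maximalIdeal S) (Ideal.IsPrime.ne_top'),
      Submodule.mem_iInf]
    intro n
    rw [FiniteMultiplicity.def, not_exists_not] at h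
    rw [ht, Ideal.span_singleton_pow, Ideal.mem_span_singleton]
    exact (pow_dvd_pow t n.le_succ).trans (h n)
  obtain ⟨v, hv, hv'⟩ := hfin.exists_eq_pow_mul_and_not_dvd
  refine ⟨_, v, by_contra fun h ↦ hv' ?_, hv⟩
  rwa [← mem_nonunits_iff, ← mem_maximalIdeal, ht, Ideal.mem_span_singleton] at h

lemma exists_mul_eq_mul_isUnit_of_not_dvd (ht : maximalIdeal S = Ideal.span {t}) {π a : S}
    (hπ : π ≠ 0) (ha : ¬ π ∣ a) : ∃ x ∈ maximalIdeal S, ∃ u, IsUnit u ∧ x * a = π * u := by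
  obtain ⟨e, w, hw, rfl⟩ := exists_eq_pow_mul_isUnit ht hπ
  obtain ⟨i, v, hv, rfl⟩ := exists_eq_pow_mul_isUnit ht
    (show a ≠ 0 from fun h ↦ ha (h ▸ dvd_zero _))
  have hie : i < e := by
    by_contra! h
    exact ha ((hw.mul_right_dvd).2 ((pow_dvd_pow t h).mul_right v))
  -- With `π = t ^ e * w` and `a = t ^ i * v`, where `i < e`, this witness makes up exactly the
  -- missing power of `t`.
  refine ⟨t ^ (e - i) * w, ?_, v, hv, ?_⟩
  · rw [ht, Ideal.mem_span_singleton]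
    exact (dvd_pow_self t (by lia)).mul_right w
  · rw [show t ^ (e - i) * w * (t ^ i * v) = t ^ (e - i) * t ^ i * w * v by ring, ← pow_add,
      Nat.sub_add_cancel hie.le]

lemma eq_bot_of_isPrime_of_ne_maximalIdeal (ht : maximalIdeal S = Ideal.span {t}) (P : Ideal S)
    [P.IsPrime] (hP : P ≠ maximalIdeal S) : P = ⊥ := by
  have htP : t ∉ P := fun h ↦ hP <| (IsLocalRing.le_maximalIdeal (Ideal.IsPrime.ne_top ‹_›)).antisymm
    (by rwa [ht, Ideal.span_singleton_le_iff_mem])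
  refine Submodule.eq_bot_of_le_smul_of_le_jacobson_bot (maximalIdeal S) P
    (IsNoetherian.noetherian P) (fun y hy ↦ ?_) (IsLocalRing.maximalIdeal_le_jacobson _)
  have := IsLocalRing.le_maximalIdeal (Ideal.IsPrime.ne_top ‹P.IsPrime›) hy
  rw [ht, Ideal.mem_span_singleton] at this
  obtain ⟨z, rfl⟩ := this
  exact Submodule.smul_mem_smul (ht ▸ Ideal.mem_span_singleton_self t)
    ((Ideal.IsPrime.mem_or_mem ‹_› hy).resolve_left htP)

lemma exists_maximalIdeal_eq_span_singleton_of_spanFinrank_le_one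
    (h : (maximalIdeal S).spanFinrank ≤ 1) : ∃ t, maximalIdeal S = Ideal.span {t} := by
  obtain h | h := Nat.le_one_iff_eq_zero_or_eq_one.1 h
  · rw [Submodule.spanFinrank_eq_zero_iff_eq_bot (IsNoetherian.noetherian _)] at h
    exact ⟨0, by rw [h, Ideal.span_singleton_eq_bot.2 rfl]⟩
  · obtain ⟨t, ht⟩ := ((Submodule.spanFinrank_eq_one_iff _).1 h).1
    exact ⟨t, ht⟩

end PrincipalMaximalIdeal

/-! ### Regularity in terms of divisibility by a nonzerodivisor -/

section Localization

variable {A : Type*} [CommRing A]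

/-- A non-multiple of `π` can be multiplied into `π` times a unit near some maximal ideal. -/
lemma exists_mul_eq_mul_of_isRegularRing [IsRegularRing A] {π a : A} (hπ : π ∈ nonZeroDivisors A)
    (hmin : ∀ p : Ideal A, p.IsPrime → π ∈ p → p.IsMaximal)
    (hπm : ∀ p : Ideal A, p.IsMaximal → π ∈ p) (ha : ¬ π ∣ a) :
    ∃ p : Ideal A, p.IsMaximal ∧ ∃ x ∈ p, ∃ u ∉ p, x * a = π * u := by
  obtain ⟨p, hp, hpa⟩ : ∃ p : Ideal A, ∃ _ : p.IsMaximal,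
      ¬ algebraMap A (Localization.AtPrime p) π ∣ algebraMap A (Localization.AtPrime p) a := by
    by_contra! h
    refine ha (Ideal.mem_span_singleton.1 (Ideal.mem_of_localization_maximal fun p hp ↦ ?_))
    rw [Ideal.map_span, Set.image_singleton, Ideal.mem_span_singleton]
    exact h p hp
  -- Krull's principal ideal theorem: `p` is minimal over `π`. Regularity then makes the maximal
  -- ideal of `A_p` principal.
  have hheight : p.height ≤ 1 :=
    Ideal.height_le_one_of_isPrincipal_of_mem_minimalPrimes (Ideal.span {π}) p
      ⟨⟨hp.isPrime, (Ideal.span_singleton_le_iff_mem _).2 (hπm p hp)⟩, fun P hP hle ↦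
        ((hmin P hP.1 (hP.2 (Ideal.mem_span_singleton_self π))).eq_of_le hp.ne_top hle).ge⟩
  have hreg : IsRegularLocalRing (Localization.AtPrime p) :=
    IsRegularRing.isRegularLocalRing_localization p
  obtain ⟨t, ht⟩ := exists_maximalIdeal_eq_span_singleton_of_spanFinrank_le_one
    (S := Localization.AtPrime p) <| by
      have h := hreg.spanFinrank_maximalIdeal
      rw [IsLocalization.AtPrime.ringKrullDim_eq_height p] at h
      have h' : ((maximalIdeal (Localization.AtPrime p)).spanFinrank : ℕ∞) = p.height := by
        exact_mod_cast h
      exact_mod_cast h'.trans_le hheight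
  have hinj : algebraMap A (Localization.AtPrime p) π ≠ 0 := fun h ↦ by
    obtain ⟨s, hs⟩ := (IsLocalization.map_eq_zero_iff p.primeCompl _ π).1 h
    exact s.2 ((mem_nonZeroDivisors_iff_right.1 hπ _ hs) ▸ p.zero_mem)
  obtain ⟨x, hx, u, hu, hxu⟩ := exists_mul_eq_mul_isUnit_of_not_dvd ht hinj hpa
  obtain ⟨⟨x, s⟩, rfl⟩ := IsLocalization.mk'_surjective p.primeCompl x
  obtain ⟨⟨u, s'⟩, rfl⟩ := IsLocalization.mk'_surjective p.primeCompl u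
  have hx' : x ∈ p := (IsLocalization.AtPrime.mk'_mem_maximal_iff _ p x s).1 hx
  have hu' : u ∉ p := (IsLocalization.AtPrime.isUnit_mk'_iff _ p u s').1 hu
  have hxu' : algebraMap A (Localization.AtPrime p) (s' * (x * a)) =
      algebraMap A (Localization.AtPrime p) (s * (π * u)) := by
    have h1 := IsLocalization.mk'_spec' (Localization.AtPrime p) x s
    have h2 := IsLocalization.mk'_spec' (Localization.AtPrime p) u s'
    simp only [map_mul]
    rw [← h1, ← h2]
    linear_combination (algebraMap A (Localization.AtPrime p) s) *
      (algebraMap A (Localization.AtPrime p) s') * hxu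
  obtain ⟨c, hc⟩ := (IsLocalization.eq_iff_exists p.primeCompl _).1 hxu'
  refine ⟨p, hp, c * s' * x, p.mul_mem_left _ hx', c * s * u, ?_, ?_⟩
  · exact fun h ↦ (hp.isPrime.mem_or_mem h).elim (c * s).2 hu'
  · linear_combination hc

variable [IsNoetherianRing A]

/-- For `y ∈ p` write `y b = π v`. Comparing with `x b = π u` and cancelling `π` gives `y u = x v`,
and `u` is a unit at `p`, so `x` generates. The height is at least one since `p` contains a
nonzerodivisor. -/
lemma isRegularLocalRing_of_forall_mem_exists {π x b : A} {p : Ideal A} [p.IsMaximal]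
    (hπ : π ∈ nonZeroDivisors A) (hπp : π ∈ p) (hx : x ∈ p) {u : A} (hu : u ∉ p)
    (hxb : x * b = π * u) (hb : ∀ y ∈ p, π ∣ y * b) :
    maximalIdeal (Localization.AtPrime p) =
      Ideal.span {algebraMap A (Localization.AtPrime p) x} ∧
    IsRegularLocalRing (Localization.AtPrime p) := by
  have hmap : p.map (algebraMap A (Localization.AtPrime p)) =
      maximalIdeal (Localization.AtPrime p) := Localization.AtPrime.map_eq_maximalIdeal
  have hspan : maximalIdeal (Localization.AtPrime p) =
      Ideal.span {algebraMap A (Localization.AtPrime p) x} := by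
    rw [← hmap]
    refine le_antisymm (Ideal.map_le_iff_le_comap.2 fun y hy ↦ ?_)
      ((Ideal.span_singleton_le_iff_mem _).2 (Ideal.mem_map_of_mem _ hx))
    obtain ⟨v, hv⟩ := hb y hy
    have hyu : y * u = x * v := by
      refine sub_eq_zero.1 ((mem_nonZeroDivisors_iff_right.1 hπ) _ ?_)
      linear_combination x * hv - y * hxb
    rw [Ideal.mem_comap, Ideal.mem_span_singleton,
      ← (IsLocalization.map_units (Localization.AtPrime p) (⟨u, hu⟩ : p.primeCompl)).dvd_mul_right]
    exact ⟨_, by rw [← map_mul, hyu, map_mul]⟩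
  refine ⟨hspan, .of_spanFinrank_maximalIdeal_le _ ?_⟩
  have hheight : 1 ≤ p.height := by
    rw [Order.one_le_iff_ne_zero, Ne, Ideal.height_eq_zero_iff]
    exact fun h ↦ Set.disjoint_left.1 (Ideal.disjoint_nonZeroDivisors_of_mem_minimalPrimes h) hπp hπ
  rw [IsLocalization.AtPrime.ringKrullDim_eq_height p]
  have : (maximalIdeal (Localization.AtPrime p)).spanFinrank ≤ 1 := by
    rw [hspan]
    exact (Submodule.spanFinrank_span_le_ncard_of_finite (Set.finite_singleton _)).trans
      (Set.ncard_singleton _).le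
  exact_mod_cast (Nat.cast_le (α := ℕ∞).2 this).trans hheight

/-- The prime `q A_p` is not maximal, hence zero, so the maximal ideal of `A_q` vanishes. -/
lemma isRegularLocalRing_of_lt {p q : Ideal A} [p.IsPrime] [q.IsPrime] (hqp : q < p)
    {t : Localization.AtPrime p} (ht : maximalIdeal (Localization.AtPrime p) = Ideal.span {t}) :
    IsRegularLocalRing (Localization.AtPrime q) := by
  have hdisj : Disjoint (p.primeCompl : Set A) q :=
    Set.disjoint_left.2 fun y hy hyq ↦ hy (hqp.le hyq)
  have hprime : (q.map (algebraMap A (Localization.AtPrime p))).IsPrime :=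
    IsLocalization.isPrime_of_isPrime_disjoint p.primeCompl _ q ‹_› hdisj
  have hbot := eq_bot_of_isPrime_of_ne_maximalIdeal ht
    (q.map (algebraMap A (Localization.AtPrime p))) fun h ↦ by
      have h1 := IsLocalization.under_map_of_isPrime_disjoint p.primeCompl
        (Localization.AtPrime p) ‹q.IsPrime› hdisj
      rw [h, Localization.AtPrime.under_maximalIdeal] at h1
      exact hqp.ne h1.symm
  have hmax : maximalIdeal (Localization.AtPrime q) = ⊥ := by
    rw [← Localization.AtPrime.map_eq_maximalIdeal, eq_bot_iff, Ideal.map_le_iff_le_comap]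
    intro y hy
    have : algebraMap A (Localization.AtPrime p) y = 0 := by
      rw [← Ideal.mem_bot, ← hbot]
      exact Ideal.mem_map_of_mem _ hy
    obtain ⟨s, hs⟩ := (IsLocalization.map_eq_zero_iff p.primeCompl _ y).1 this
    exact (IsLocalization.map_eq_zero_iff q.primeCompl _ y).2 ⟨⟨s, fun h ↦ s.2 (hqp.le h)⟩, hs⟩
  refine .of_spanFinrank_maximalIdeal_le _ ?_
  rw [hmax, Submodule.spanFinrank_bot]
  exact ringKrullDim_nonneg_of_nontrivial

end Localization

/-! ### Regularity against annihilation of the trace cokernel by the maximal ideal -/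

section TameRegular

lemma algebraMap_dvd_of_forall_dual {R A : Type*} [CommRing R] [CommRing A] [Algebra R A]
    [Module.Finite R A] [Module.Free R A] {π : R} {b : A}
    (h : ∀ φ : Module.Dual R A, π ∣ φ b) : algebraMap R A π ∣ b := by
  let e := Module.Free.chooseBasis R A
  choose f hf using fun i ↦ h (e.coord i)
  refine ⟨∑ i, f i • e i, ?_⟩
  rw [← Algebra.smul_def, Finset.smul_sum]
  conv_lhs => rw [← e.sum_repr b]
  refine Finset.sum_congr rfl fun i _ ↦ ?_
  rw [smul_smul, ← hf i, e.coord_apply]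

variable {R : Type*} [CommRing R] [IsDomain R] [IsDiscreteValuationRing R] {A : Type*}
  [CommRing A] [Algebra R A]

lemma smul_top_traceCokernel_eq_bot_iff {π : R} (hπ : Irreducible π) :
    maximalIdeal R • (⊤ : Submodule R (TraceCokernel R A)) = ⊥ ↔
      ∀ φ : Module.Dual R A, ∃ x, Algebra.traceForm R A x = π • φ := by
  rw [hπ.maximalIdeal_eq, Submodule.ideal_span_singleton_smul, eq_bot_iff]
  refine ⟨fun h φ ↦ ?_, fun h ↦ ?_⟩
  · have := h (Submodule.smul_mem_pointwise_smul (Submodule.Quotient.mk φ) π ⊤ trivial)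
    rwa [← Submodule.Quotient.mk_smul, Submodule.mem_bot, Submodule.Quotient.mk_eq_zero] at this
  · rintro _ ⟨y, -, rfl⟩
    obtain ⟨φ, rfl⟩ := Submodule.Quotient.mk_surjective _ y
    exact (Submodule.Quotient.mk_eq_zero _).2 (h φ)

lemma algebraMap_mem_nonZeroDivisors [Module.Free R A] {π : R} (hπ : π ≠ 0) :
    algebraMap R A π ∈ nonZeroDivisors A := by
  rw [mem_nonZeroDivisors_iff_right]
  intro a ha
  rw [mul_comm, ← Algebra.smul_def] at ha
  exact (smul_eq_zero.1 ha).resolve_left hπ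

lemma algebraMap_mem_of_isMaximal [Module.Finite R A] {π : R} (hπ : Irreducible π)
    (p : Ideal A) (hp : p.IsMaximal) :
    algebraMap R A π ∈ p := by
  have := liesOver_of_isMaximal (R := R) p
  rw [← Ideal.mem_of_liesOver p (maximalIdeal R), hπ.maximalIdeal_eq]
  exact Ideal.mem_span_singleton_self π

lemma isMaximal_of_algebraMap_mem [Module.Finite R A] {π : R} (hπ : Irreducible π)
    (p : Ideal A) (hp : p.IsPrime) (h : algebraMap R A π ∈ p) : p.IsMaximal := by
  have hle : maximalIdeal R ≤ p.comap (algebraMap R A) := by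
    rwa [hπ.maximalIdeal_eq, Ideal.span_singleton_le_iff_mem]
  have hmax : (p.comap (algebraMap R A)).IsMaximal := by
    rw [← (maximalIdeal.isMaximal R).eq_of_le (Ideal.comap_ne_top _ hp.ne_top) hle]
    exact maximalIdeal.isMaximal R
  exact Ideal.isMaximal_of_isIntegral_of_isMaximal_comap p hmax

variable [Module.Finite R A] [Module.Free R A]

/-- If the trace form modulo `m_R` has the Jacobson radical as its kernel and `m_R` kills the
trace cokernel, then `A` is regular. -/
theorem isRegularRing_of_forall_exists_traceForm_eq {π : R} (hπ : Irreducible π)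
    (hJ : ∀ a : A, (∀ y, Algebra.trace R A (a * y) ∈ maximalIdeal R) ↔
      ∀ p : Ideal A, p.IsMaximal → a ∈ p)
    (hQ : ∀ φ : Module.Dual R A, ∃ x, Algebra.traceForm R A x = π • φ) : IsRegularRing A := by
  have hnoeth : IsNoetherianRing A := .of_finite R A
  have hnzd := algebraMap_mem_nonZeroDivisors (A := A) hπ.ne_zero
  have hdvd {r : R} : r ∈ maximalIdeal R ↔ π ∣ r := by
    rw [hπ.maximalIdeal_eq, Ideal.mem_span_singleton]
  have key (p : Ideal A) [hp : p.IsMaximal] : ∃ x,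
      maximalIdeal (Localization.AtPrime p) =
        Ideal.span {algebraMap A (Localization.AtPrime p) x} ∧
      IsRegularLocalRing (Localization.AtPrime p) := by
    -- As `p` is minimal over `π`, it is an associated prime of `A ⧸ (π)`; `b` lifts an element with
    -- annihilator `p`.
    obtain ⟨b, hb, hpb⟩ : ∃ b, ¬ algebraMap R A π ∣ b ∧ ∀ y ∈ p, algebraMap R A π ∣ y * b := by
      have hass : p ∈ associatedPrimes A (A ⧸ Ideal.span {algebraMap R A π}) := by
        apply Module.associatedPrimes.minimalPrimes_annihilator_subset_associatedPrimes
        rw [Ideal.annihilator_quotient]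
        exact ⟨⟨hp.isPrime, (Ideal.span_singleton_le_iff_mem _).2
          (algebraMap_mem_of_isMaximal hπ p hp)⟩, fun P hP hle ↦
          ((isMaximal_of_algebraMap_mem hπ P hP.1
            (hP.2 (Ideal.mem_span_singleton_self _))).eq_of_le hp.ne_top hle).ge⟩
      rw [AssociatedPrimes.mem_iff, isAssociatedPrime_iff] at hass
      obtain ⟨-, z, hz⟩ := hass
      obtain ⟨b, rfl⟩ := Ideal.Quotient.mk_surjective z
      have hz' (y : A) : y ∈ p ↔ algebraMap R A π ∣ y * b := by
        rw [hz, Submodule.mem_colon_singleton, Submodule.mem_bot, Algebra.smul_def,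
          Ideal.Quotient.algebraMap_eq, ← map_mul, Ideal.Quotient.eq_zero_iff_mem,
          Ideal.mem_span_singleton]
      refine ⟨b, fun h ↦ hp.ne_top ((Ideal.eq_top_iff_one p).2 ((hz' 1).2 ?_)),
        fun y hy ↦ (hz' y).1 hy⟩
      rwa [one_mul]
    obtain ⟨x, hx, u, hu, hxu⟩ : ∃ x ∈ p, ∃ u ∉ p, x * b = algebraMap R A π * u := by
      -- Otherwise, for `tr(x·) = πφ` and `x b = π v`, also `v` lies in the Jacobson radical; then
      -- `φ b = tr v` is divisible by `π` for every `φ`, forcing `π ∣ b`.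
      by_contra! hcon
      refine hb (algebraMap_dvd_of_forall_dual fun φ ↦ ?_)
      obtain ⟨x, hx⟩ := hQ φ
      have htr (y : A) : Algebra.trace R A (x * y) = π * φ y := LinearMap.congr_fun hx y
      have hxJ := (hJ x).1 fun y ↦ hdvd.2 ⟨φ y, htr y⟩
      obtain ⟨v, hv⟩ := hpb x (hxJ p hp)
      have hvJ : ∀ q : Ideal A, q.IsMaximal → v ∈ q := by
        intro q hq
        by_cases hqp : p = q
        · exact hqp ▸ by_contra fun h ↦ hcon x (hxJ p hp) v h hv
        -- At another maximal ideal `q`, an `s ∈ p` outside `q` satisfies `s v = x v' ∈ q`, so `v ∈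
        -- q`.
        obtain ⟨s, hs, hsq⟩ := SetLike.not_le_iff_exists.1 fun h ↦ hqp (hp.eq_of_le hq.ne_top h)
        obtain ⟨v', hv'⟩ := hpb s hs
        have : s * v = x * v' := by
          refine sub_eq_zero.1 ((mem_nonZeroDivisors_iff_right.1 hnzd) _ ?_)
          linear_combination x * hv' - s * hv
        exact (hq.isPrime.mem_or_mem (this ▸ q.mul_mem_right v' (hxJ q hq))).resolve_left hsq
      have h1 := (hJ v).2 hvJ 1
      have h2 := htr b
      rw [hv, ← Algebra.smul_def, map_smul, smul_eq_mul] at h2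
      rw [← mul_left_cancel₀ hπ.ne_zero h2, ← hdvd]
      rwa [mul_one] at h1
    exact ⟨x, isRegularLocalRing_of_forall_mem_exists hnzd
      (algebraMap_mem_of_isMaximal hπ p hp) hx hu hxu hpb⟩
  refine isRegularRing_iff.2 fun q hq ↦ ?_
  by_cases hmax : q.IsMaximal
  · exact (key q).choose_spec.2
  obtain ⟨p, hp, hle⟩ := q.exists_le_maximal hq.ne_top
  obtain ⟨x, hx, -⟩ := key p
  exact isRegularLocalRing_of_lt (hle.lt_of_ne fun h ↦ hmax (h ▸ hp)) hx

/-- If the trace form modulo `m_R` has the Jacobson radical as its kernel and `A` is regular,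
then `m_R` kills the trace cokernel. -/
theorem forall_exists_traceForm_eq_of_isRegularRing (B : Type*) [CommRing B]
    [Algebra (ResidueField R) B] [Algebra A B] [Algebra R B] [IsScalarTower R (ResidueField R) B]
    [IsScalarTower R A B] [Algebra.IsPushout R (ResidueField R) A B]
    [IsRegularRing A] {π : R} (hπ : Irreducible π)
    (hJ : ∀ a : A, (∀ y, Algebra.trace R A (a * y) ∈ maximalIdeal R) ↔
      ∀ p : Ideal A, p.IsMaximal → a ∈ p)
    (hsep : ∀ p : Ideal A, p.IsMaximal → ∃ y ∉ p, ∀ q : Ideal A, q.IsMaximal → q ≠ p → y ∈ q)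
    (φ : Module.Dual R A) : ∃ x, Algebra.traceForm R A x = π • φ := by
  have hdvd {r : R} : r ∈ maximalIdeal R ↔ π ∣ r := by
    rw [hπ.maximalIdeal_eq, Ideal.mem_span_singleton]
  have hfin := moduleFinite_fibre R A B
  let W : Submodule R (Module.Dual R A) :=
    { carrier := {φ | ∃ x, Algebra.traceForm R A x = π • φ}
      add_mem' := by
        rintro φ ψ ⟨x, hx⟩ ⟨y, hy⟩
        exact ⟨x + y, by rw [map_add, hx, hy, smul_add]⟩
      zero_mem' := ⟨0, by simp⟩
      smul_mem' := by
        rintro r φ ⟨x, hx⟩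
        exact ⟨r • x, by rw [map_smul, hx, smul_comm]⟩ }
  let U : Submodule (ResidueField R) (Module.Dual (ResidueField R) B) :=
    { W.map (dualReduction B) with
      smul_mem' := by
        rintro c _ ⟨φ, hφ, rfl⟩
        obtain ⟨r, rfl⟩ := residue_surjective c
        refine ⟨r • φ, W.smul_mem r hφ, ?_⟩
        rw [map_smul, ← ResidueField.algebraMap_eq, algebraMap_smul] }
  -- For `a ∉ πA` a form in `W` with unit value at `a` is needed. From `x a = π u` near `p`, the
  -- factor `y` pushes `x` into the Jacobson radical without losing `u y ∉ p`; then `ψ = π⁻¹ tr(x y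
  -- z ·)` has `ψ a = tr(u y z)`, a unit for suitable `z`.
  have hU : U.dualCoannihilator = ⊥ := by
    refine eq_bot_iff.2 fun b hb ↦ ?_
    obtain ⟨a, rfl⟩ := algebraMap_fibre_surjective R A B b
    rw [Submodule.mem_dualCoannihilator] at hb
    rw [Submodule.mem_bot]
    by_contra ha
    have ha' : ¬ algebraMap R A π ∣ a := by
      rintro ⟨c, rfl⟩
      refine ha ?_
      rw [map_mul, ← IsScalarTower.algebraMap_apply, IsScalarTower.algebraMap_apply R
        (ResidueField R) B, ResidueField.algebraMap_eq, (residue_eq_zero_iff π).2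
        (hdvd.2 dvd_rfl), map_zero, zero_mul]
    obtain ⟨p, hp, x, hx, u, hu, hxu⟩ := exists_mul_eq_mul_of_isRegularRing
      (algebraMap_mem_nonZeroDivisors (A := A) hπ.ne_zero) (isMaximal_of_algebraMap_mem hπ)
      (algebraMap_mem_of_isMaximal hπ) ha'
    obtain ⟨y, hyp, hy⟩ := hsep p hp
    have hxyJ : ∀ q : Ideal A, q.IsMaximal → x * y ∈ q := fun q hq ↦ by
      by_cases h : q = p
      · exact h ▸ p.mul_mem_right y hx
      · exact q.mul_mem_left x (hy q hq h)
    obtain ⟨z, hz⟩ : ∃ z, Algebra.trace R A (u * y * z) ∉ maximalIdeal R := by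
      by_contra! h
      exact (hp.isPrime.mem_or_mem ((hJ _).1 h p hp)).elim hu hyp
    obtain ⟨ψ, hψ⟩ := exists_smul_eq_of_forall_dvd hπ.ne_zero
      (Algebra.traceForm R A (x * y * z)) fun w ↦ hdvd.1 <| by
        rw [Algebra.traceForm_apply, mul_assoc]
        exact (hJ _).2 hxyJ _
    have h1 := hb _ ⟨ψ, ⟨_, hψ.symm⟩, rfl⟩
    rw [dualReduction_apply_algebraMap, residue_eq_zero_iff] at h1
    have h2 := LinearMap.congr_fun hψ a
    rw [Algebra.traceForm_apply, show x * y * z * a = algebraMap R A π * (u * y * z) by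
      linear_combination y * z * hxu, ← Algebra.smul_def, map_smul, LinearMap.smul_apply,
      smul_eq_mul, smul_eq_mul] at h2
    exact hz (mul_left_cancel₀ hπ.ne_zero h2 ▸ h1)
  have hUtop : U = ⊤ := by
    rw [← Subspace.dualCoannihilator_dualAnnihilator_eq (W := U), hU,
      Submodule.dualAnnihilator_bot]
  -- Nakayama: `W` generates the dual modulo `π`.
  have hW : (⊤ : Submodule R (Module.Dual R A)) ≤ W := by
    refine Submodule.le_of_le_smul_of_le_jacobson_bot (I := maximalIdeal R) Module.Finite.fg_top
      (IsLocalRing.maximalIdeal_le_jacobson _) fun φ _ ↦ ?_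
    have : dualReduction B φ ∈ U := hUtop ▸ trivial
    obtain ⟨ψ, hψ, hφψ⟩ := this
    rw [eq_comm, ← sub_eq_zero, ← map_sub, dualReduction_eq_zero_iff B hπ] at hφψ
    obtain ⟨χ, hχ⟩ := hφψ
    rw [show φ = ψ + π • χ by rw [hχ]; abel]
    exact Submodule.add_mem_sup hψ (Submodule.smul_mem_smul (hdvd.2 dvd_rfl) trivial)
  exact hW (Submodule.mem_top (x := φ))

end TameRegular

/-! ### The Jacobson radical as kernel of the reduced trace form, and the theorem -/

section Main

variable {R : Type*} [CommRing R] [IsDomain R] [IsDiscreteValuationRing R] {A : Type*}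
  [CommRing A] [Algebra R A] [Module.Finite R A]
  (B : Type*) [CommRing B] [Algebra (ResidueField R) B] [Algebra A B]
  [Algebra R B] [IsScalarTower R (ResidueField R) B] [IsScalarTower R A B]
  [Algebra.IsPushout R (ResidueField R) A B]

variable (R) in
include R in
lemma exists_fibre_maximalSpectrum_under_eq (p : Ideal A) [p.IsMaximal] :
    ∃ q : MaximalSpectrum B, q.asIdeal.under A = p := by
  have := liesOver_of_isMaximal (R := R) p
  let _ : Algebra (ResidueField R) (A ⧸ p) :=
    inferInstanceAs (Algebra (R ⧸ maximalIdeal R) (A ⧸ p))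
  have : IsScalarTower R (ResidueField R) (A ⧸ p) :=
    inferInstanceAs (IsScalarTower R (R ⧸ maximalIdeal R) (A ⧸ p))
  exact exists_maximalSpectrum_under_eq (R := R) (k := ResidueField R) residue_surjective p

variable (R) in
include R in
lemma forall_isMaximal_mem_iff (a : A) : (∀ p : Ideal A, p.IsMaximal → a ∈ p) ↔
    ∀ q : MaximalSpectrum B, algebraMap A B a ∈ q.asIdeal := by
  refine ⟨fun h q ↦ h (q.asIdeal.under A) ?_, fun h p hp ↦ ?_⟩
  · exact Ideal.comap_isMaximal_of_surjective _ (algebraMap_fibre_surjective R A B)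
  · obtain ⟨q, rfl⟩ := exists_fibre_maximalSpectrum_under_eq R B p
    exact h q

variable (R A) in
include R B in
lemma finite_maximalSpectrum_of_fibre : Finite (MaximalSpectrum A) := by
  have := moduleFinite_fibre R A B
  have hart : IsArtinianRing B := isArtinian_of_tower (ResidueField R) inferInstance
  refine Finite.of_surjective (fun q : MaximalSpectrum B ↦ (⟨q.asIdeal.under A,
    Ideal.comap_isMaximal_of_surjective _ (algebraMap_fibre_surjective R A B)⟩ :
      MaximalSpectrum A)) fun p ↦ ?_
  have := p.isMaximal
  obtain ⟨q, hq⟩ := exists_fibre_maximalSpectrum_under_eq R B p.asIdeal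
  exact ⟨q, MaximalSpectrum.ext hq⟩

lemma trace_mul_mem_iff [Module.Free R A] [Fintype (MaximalSpectrum B)] {c : MaximalSpectrum B → ℕ}
    (hc : ∀ b, Algebra.trace (ResidueField R) B b = ∑ q, (c q : ResidueField R) *
      Algebra.trace (ResidueField R) (B ⧸ q.asIdeal) (Ideal.Quotient.mk _ b))
    (h : ∀ q, (c q : ResidueField R) ≠ 0 ∧
      Algebra.IsSeparable (ResidueField R) (B ⧸ q.asIdeal)) (a : A) :
    (∀ y, Algebra.trace R A (a * y) ∈ maximalIdeal R) ↔
      ∀ p : Ideal A, p.IsMaximal → a ∈ p := by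
  have := moduleFinite_fibre R A B
  rw [forall_isMaximal_mem_iff R B, ← ker_traceForm_eq_of_tame hc h,
    (algebraMap_fibre_surjective R A B).forall]
  refine forall_congr' fun y ↦ ?_
  rw [← map_mul, trace_algebraMap_of_isPushout, residue_eq_zero_iff]

end Main

lemma exists_notMem_forall_mem {A : Type*} [CommRing A] [Finite (MaximalSpectrum A)]
    (p : Ideal A) (hp : p.IsMaximal) : ∃ y ∉ p, ∀ q : Ideal A, q.IsMaximal → q ≠ p → y ∈ q := by
  classical
  obtain ⟨y, hy⟩ := Ideal.pi_quotient_surjective (I := fun q : MaximalSpectrum A ↦ q.asIdeal)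
    (fun _ _ h ↦ MaximalSpectrum.isCoprime_of_ne h) (Pi.single ⟨p, hp⟩ 1)
  refine ⟨y, fun h ↦ ?_, fun q hq hqp ↦ ?_⟩
  · have := hy ⟨p, hp⟩
    rw [Pi.single_eq_same, Ideal.Quotient.eq_zero_iff_mem.2 h] at this
    have : Nontrivial (A ⧸ p) := Ideal.Quotient.nontrivial_iff.2 hp.ne_top
    exact zero_ne_one ‹(0 : A ⧸ p) = 1›
  · have := hy ⟨q, hq⟩
    rw [Pi.single_eq_of_ne (fun h ↦ hqp (congrArg MaximalSpectrum.asIdeal h))] at this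
    exact Ideal.Quotient.eq_zero_iff_mem.1 this

/-- Equality forces `T`, hence `ℓ`, to be finite; then `T + g = n` reads `(g - r) + ℓ = 0` with both
terms nonnegative. -/
lemma add_eq_iff_of_add_eq_add {T ℓ : ℕ∞} {r g n : ℕ} (h : T + r = n + ℓ) (hr : r ≤ g) :
    T + g = n ↔ r = g ∧ ℓ = 0 := by
  refine ⟨fun hT ↦ ?_, fun ⟨hg, hl⟩ ↦ by rw [← hg, h, hl, add_zero]⟩
  have hT' : T ≠ ⊤ := fun h' ↦ by simp [h'] at hT
  lift T to ℕ using hT'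
  have hl : ℓ ≠ ⊤ := fun h' ↦ by
    rw [h', add_top] at h
    exact ENat.natCast_ne_top _ (by exact_mod_cast h : ((T + r : ℕ) : ℕ∞) = ⊤)
  lift ℓ to ℕ using hl
  norm_cast at *
  lia

end FiniteFlatExtension

/-- The bound is stated additively because subtraction in `ℕ∞` truncates. -/
theorem theoremA (R : Type*) [CommRing R] [IsDomain R] [IsDiscreteValuationRing R]
    (A : Type*) [CommRing A] [Algebra R A] [Module.Finite R A] [Module.Flat R A] :
    (Module.finrank R A : ℕ∞) ≤
        FiniteFlatExtension.traceLength R A + FiniteFlatExtension.geometricPoints R A ∧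
      List.TFAE [
        FiniteFlatExtension.traceLength R A + FiniteFlatExtension.geometricPoints R A =
          (Module.finrank R A : ℕ∞),
        IsRegularRing A ∧ FiniteFlatExtension.IsTame R A ∧
          FiniteFlatExtension.HasSeparableResidueFields R A,
        (FiniteFlatExtension.IsTame R A ∧ FiniteFlatExtension.HasSeparableResidueFields R A) ∧
          IsLocalRing.maximalIdeal R •
            (⊤ : Submodule R (FiniteFlatExtension.TraceCokernel R A)) = ⊥] := by
  have hfree : Module.Free R A := Module.free_of_flat_of_isLocalRing
  let k := IsLocalRing.ResidueField R
  let B := k ⊗[R] A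
  let _ : Algebra A B := Algebra.TensorProduct.rightAlgebra
  have hpush : Algebra.IsPushout R k A B := TensorProduct.isPushout
  have hart : IsArtinianRing B := isArtinian_of_tower k inferInstance
  let _ : Fintype (MaximalSpectrum B) := Fintype.ofFinite _
  obtain ⟨c, hc, htr⟩ := FiniteFlatExtension.exists_multiplicity_trace_eq_sum k B
  have hlen := FiniteFlatExtension.traceLength_add_finrank_range (R := R) (A := A) B
  have hle := FiniteFlatExtension.finrank_range_traceForm_le htr
  have heq := FiniteFlatExtension.finrank_range_traceForm_eq_iff htr
  have htame := FiniteFlatExtension.isTame_and_hasSeparableResidueFields_iff (R := R) (A := A) hc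
  have hgeom := FiniteFlatExtension.geometricPoints_eq_sum R A (B := B) AlgEquiv.refl
  obtain ⟨π, hπ⟩ := IsDiscreteValuationRing.exists_irreducible R
  refine ⟨?_, ?_⟩
  · rw [hgeom]
    calc (Module.finrank R A : ℕ∞) ≤ _ := le_self_add
      _ = _ := hlen.symm
      _ ≤ _ := by gcongr
  tfae_have 1 ↔ 3 := by
    rw [hgeom, FiniteFlatExtension.add_eq_iff_of_add_eq_add hlen hle, htame, ← heq,
      Module.length_eq_zero_iff, Submodule.subsingleton_iff_eq_bot]
  tfae_have 2 → 3 := fun ⟨hreg, ht⟩ ↦ by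
    have := FiniteFlatExtension.finite_maximalSpectrum_of_fibre R A B
    exact ⟨ht, (FiniteFlatExtension.smul_top_traceCokernel_eq_bot_iff hπ).2
      (FiniteFlatExtension.forall_exists_traceForm_eq_of_isRegularRing B hπ
        (FiniteFlatExtension.trace_mul_mem_iff B htr (htame.1 ht))
        FiniteFlatExtension.exists_notMem_forall_mem)⟩
  tfae_have 3 → 2 := fun ⟨ht, hQ⟩ ↦
    ⟨FiniteFlatExtension.isRegularRing_of_forall_exists_traceForm_eq hπ
      (FiniteFlatExtension.trace_mul_mem_iff B htr (htame.1 ht))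
      ((FiniteFlatExtension.smul_top_traceCokernel_eq_bot_iff hπ).1 hQ), ht⟩
  tfae_finish
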